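/- For a real Hilbert space $\mathcal E$, let $\Gamma_0(\mathcal E)$ be the class of lower semicontinuous convex functions $f\colon\mathcal E\to\left]-\infty,+\infty\right]$ that are not identically $+\infty$. For $f\in\Gamma_0(\mathcal E)$ and $x\in\mathcal E$, let $\operatorname{prox}_f x$ be the unique minimizer of $y\mapsto f(y)+\frac12\|x-y\|^2$ over $\mathcal E$. For $f\colon\mathcal E\to[-\infty,+\infty]$, let $f^*\colon u\mapsto\sup_{x\in\mathcal E}\big(\langle x,u\rangle-f(x)\big)$ be its conjugate; for $f,h\colon\mathcal E\to\left]-\infty,+\infty\right]$, let $f\,\square\,h\colon x\mapsto\inf_{y\in\mathcal E}\big(f(y)+h(x-y)\big)$ be their infimal convolution. An operator $F\colon\mathcal E\to\mathcal E$ is firmly nonexpansive if $\|Fx-Fy\|^2+\|(x-Fx)-(y-Fy)\|^2\le\|x-y\|^2$ for all $x,y\in\mathcal E$; a point $p$ is called the proximal point of $x$ relative to $F$ if $F$ is firmly nonexpansive and $p=Fx$. **Proposition.** Let $\mathcal H$ be a real Hilbert space, let $(\mathcal G_i)_{i\in\mathbb I}$ be a nonempty finite family of real Hilbert spaces, and let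 $\overline x\in\mathcal H$. For every $i\in\mathbb I$, let $g_i\in\Gamma_0(\mathcal G_i)$, let $L_i\colon\mathcal H\to\mathcal G_i$ be a nonzero bounded linear operator, and set $q_i=\operatorname{prox}_{g_i}(L_i\overline x)$. Set $$\beta=\frac{1}{\sum_{i\in\mathbb I}\|L_i\|^2},\qquad p=\beta\sum_{i\in\mathbb I}L_i^*q_i,\qquad F=\beta\sum_{i\in\mathbb I}L_i^*\circ\operatorname{prox}_{g_i}\circ L_i .$$ Then the following hold: 1. $p$ is the proximal point of $\overline x$ relative to $F$ (that is, $F$ is firmly nonexpansive and $p=F\overline x$). 2. For every $x\in\mathcal H$: $Fx=p$ if and only if $\operatorname{prox}_{g_i}(L_ix)=q_i$ for every $i\in\mathbb I$. 3. If $\beta\ge1$, then the function $$f=\Bigg(\sum_{i\in\mathbb I}\Big(g_i^*\,\square\,\frac{\|\cdot\|_{\mathcal G_i}^2}{2}\Big)\circ L_i\Bigg)^{*}-\frac{\|\cdot\|_{\mathcal H}^2}{2}$$ belongs to $\Gamma_0(\mathcal H)$, and $F=\beta\operatorname{prox}_f$. -/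

import Mathlib

noncomputable section

/-- `GammaZero f` says that `f` belongs to `Γ₀(E)`: `f` never takes the value `-∞`, is not
identically `+∞`, is lower semicontinuous, and is convex. -/
structure GammaZero {E : Type*} [NormedAddCommGroup E] [InnerProductSpace ℝ E]
    (f : E → EReal) : Prop where
  ne_bot : ∀ x, f x ≠ ⊥
  proper : ∃ x, f x ≠ ⊤
  lsc : LowerSemicontinuous f
  convex : ∀ x y : E, ∀ a b : ℝ, 0 < a → 0 < b → a + b = 1 →
    f (a • x + b • y) ≤ (a : EReal) * f x + (b : EReal) * f y

/-- The function `‖·‖² / 2`. -/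
def halfSqNorm {E : Type*} [NormedAddCommGroup E] (x : E) : EReal :=
  ((‖x‖ ^ 2 / 2 : ℝ) : EReal)

/-- `IsProx f x p`: `p` is the unique minimizer of `y ↦ f y + ‖x - y‖² / 2`. -/
def IsProx {E : Type*} [NormedAddCommGroup E] (f : E → EReal) (x p : E) : Prop :=
  ∀ y, y ≠ p → f p + halfSqNorm (x - p) < f y + halfSqNorm (x - y)

/-- The proximity operator: `proxOp f x` is the unique minimizer of `y ↦ f y + ‖x - y‖² / 2`
(an arbitrary point when there is none; there always is one when `f ∈ Γ₀(E)` and `E` is a real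
Hilbert space). -/
def proxOp {E : Type*} [NormedAddCommGroup E] (f : E → EReal) (x : E) : E :=
  Classical.epsilon (IsProx f x)

/-- The (Fenchel) conjugate `f^* u = sup_x (⟪x, u⟫ - f x)`. -/
def fenchelConj {E : Type*} [NormedAddCommGroup E] [InnerProductSpace ℝ E]
    (f : E → EReal) (u : E) : EReal :=
  ⨆ x : E, ((inner ℝ x u : ℝ) : EReal) - f x

/-- The infimal convolution `(f □ g) x = inf_y (f y + g (x - y))`. -/
def infConv {E : Type*} [AddCommGroup E] (f g : E → EReal) (x : E) : EReal :=
  ⨅ y : E, f y + g (x - y)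

/-- Firmly nonexpansive operators. -/
def FirmlyNonexpansive {E : Type*} [NormedAddCommGroup E] (F : E → E) : Prop :=
  ∀ x y, ‖F x - F y‖ ^ 2 + ‖(x - F x) - (y - F y)‖ ^ 2 ≤ ‖x - y‖ ^ 2

/-- `p` is the proximal point of `x` relative to the operator `F`: the operator `F` is firmly
nonexpansive and `p = F x`. -/
def IsProximalPoint {E : Type*} [NormedAddCommGroup E] (F : E → E) (x p : E) : Prop :=
  FirmlyNonexpansive F ∧ p = F x

end

open Filter Topology

/-! Items 1 and 2 share one estimate, `hmono`: firm nonexpansiveness of each prox, summed, bounds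
⟪Fx - Fy, x - y⟫ below by β times the sum of the squared prox differences. Cauchy–Schwarz and the
choice of β turn this into firm nonexpansiveness; when Fx = p it forces every difference to vanish.
For item 3, `exists_envelope` makes `proxOp g` the gradient of a convex Moreau envelope with
1-Lipschitz-type quadratic upper bounds. If β ≥ 1, the sum of the composed envelopes inherits
modulus 1, and `gammaZero_conj_sub_halfSqNorm` shows that its gradient is a prox. -/

lemma IsProx.eq {E : Type*} [NormedAddCommGroup E] {g : E → EReal} {x p p' : E} (h : IsProx g x p) (h' : IsProx g x p') :
    p = p' := by
  by_contra hne
  exact lt_asymm (h p' (Ne.symm hne)) (h' p hne)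

lemma IsProx.proxOp_eq {E : Type*} [NormedAddCommGroup E] {g : E → EReal} {x p : E} (h : IsProx g x p) : proxOp g x = p :=
  (Classical.epsilon_spec (p := IsProx g x) ⟨p, h⟩ : IsProx g x (proxOp g x)).eq h

/-! ### Proximity operators of functions in Γ₀ -/

section Prox

variable {E : Type*} [NormedAddCommGroup E] [InnerProductSpace ℝ E]

lemma GammaZero.eq_top_or_coe {g : E → EReal} (hg : GammaZero g) (y : E) :
    g y = ⊤ ∨ ∃ b : ℝ, g y = b := by
  by_cases h : g y = ⊤
  · exact Or.inl h
  · exact Or.inr ⟨(g y).toReal, (EReal.coe_toReal h (hg.ne_bot y)).symm⟩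

lemma GammaZero.exists_coe {g : E → EReal} (hg : GammaZero g) : ∃ (y : E) (b : ℝ), g y = b := by
  obtain ⟨y, hy⟩ := hg.proper
  exact ⟨y, (hg.eq_top_or_coe y).resolve_left hy⟩

lemma GammaZero.convex_coe {g : E → EReal} (hg : GammaZero g) {x y : E} {a b s t : ℝ}
    (hx : g x = a) (hy : g y = b) (hs : 0 < s) (ht : 0 < t) (hst : s + t = 1) :
    ∃ c : ℝ, g (s • x + t • y) = c ∧ c ≤ s * a + t * b := by
  have h := hg.convex x y s t hs ht hst
  rw [hx, hy] at h
  rcases hg.eq_top_or_coe (s • x + t • y) with h' | ⟨c, hc⟩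
  · rw [h', top_le_iff] at h
    exact absurd h (by exact_mod_cast EReal.coe_ne_top (s * a + t * b))
  · refine ⟨c, hc, ?_⟩
    rw [hc] at h
    exact_mod_cast h

/-- A function in `Γ₀(E)` is bounded below by a function of linear growth. -/
lemma GammaZero.exists_linear_minorant {g : E → EReal} (hg : GammaZero g) :
    ∃ (x₀ : E) (m c : ℝ), 0 ≤ c ∧ ∀ (y : E) (b : ℝ), g y = b → m - c * ‖y - x₀‖ ≤ b := by
  obtain ⟨x₀, a, ha⟩ := hg.exists_coe
  have hlt : ((a - 1 : ℝ) : EReal) < g x₀ := by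
    rw [ha]; exact_mod_cast sub_one_lt a
  obtain ⟨r, hr, hball⟩ := Metric.eventually_nhds_iff.1 (hg.lsc x₀ _ hlt)
  refine ⟨x₀, a - 1, 2 / r, by positivity, fun y b hb => ?_⟩
  by_cases hy : ‖y - x₀‖ < r
  · have h1 := hball (y := y) (by rwa [dist_eq_norm])
    simp only [hb] at h1
    have h2 : a - 1 < b := by exact_mod_cast h1
    have : 0 ≤ 2 / r * ‖y - x₀‖ := by positivity
    linarith
  · push Not at hy
    have hn : 0 < ‖y - x₀‖ := hr.trans_le hy
    -- This puts the convex combination at distance r/2 from x₀, where lower semicontinuity bounds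
    -- g.
    set t : ℝ := r / 2 / ‖y - x₀‖ with ht
    have ht0 : 0 < t := by positivity
    have htn : t * ‖y - x₀‖ = r / 2 := by rw [ht]; field_simp
    have ht1 : t < 1 := by
      rw [ht, div_lt_one hn]; linarith
    obtain ⟨c, hc, hcle⟩ := hg.convex_coe ha hb (sub_pos.2 ht1) ht0 (by ring)
    have hz : (1 - t) • x₀ + t • y - x₀ = t • (y - x₀) := by module
    have h1 := hball (y := (1 - t) • x₀ + t • y) (by
      rw [dist_eq_norm, hz, norm_smul, Real.norm_of_nonneg ht0.le, htn]; linarith)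
    simp only [hc] at h1
    have h2 : a - 1 < c := by exact_mod_cast h1
    have h3 : t * (a - b) < 1 := by nlinarith
    have h4 : t * (2 / r * ‖y - x₀‖) = 1 := by
      rw [mul_left_comm, htn]; field_simp
    have h5 : a - b < 2 / r * ‖y - x₀‖ := by
      rw [← h4] at h3
      exact lt_of_mul_lt_mul_left h3 ht0.le
    linarith

lemma GammaZero.bddBelow_add_half_sq {g : E → EReal} (hg : GammaZero g) (x : E) :
    ∃ m : ℝ, ∀ (y : E) (b : ℝ), g y = b → m ≤ b + ‖x - y‖ ^ 2 / 2 := by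
  obtain ⟨x₀, m, c, hc, h⟩ := hg.exists_linear_minorant
  refine ⟨m - c * ‖x - x₀‖ - c ^ 2 / 2, fun y b hb => ?_⟩
  have h1 := h y b hb
  have h2 : ‖y - x₀‖ ≤ ‖x - y‖ + ‖x - x₀‖ := by
    have := norm_sub_le (x - x₀) (x - y)
    rw [sub_sub_sub_cancel_left] at this
    linarith
  nlinarith [mul_le_mul_of_nonneg_left h2 hc, sq_nonneg (‖x - y‖ - c)]

/-- Existence of a minimizer of `y ↦ g y + ‖x - y‖² / 2`. -/
lemma GammaZero.exists_minimizer [CompleteSpace E] {g : E → EReal} (hg : GammaZero g) (x : E) :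
    ∃ (p : E) (a : ℝ), g p = a ∧
      ∀ (y : E) (b : ℝ), g y = b → a + ‖x - p‖ ^ 2 / 2 ≤ b + ‖x - y‖ ^ 2 / 2 := by
  obtain ⟨m₀, hm₀⟩ := hg.bddBelow_add_half_sq x
  let S : Set ℝ := {r | ∃ (y : E) (b : ℝ), g y = b ∧ r = b + ‖x - y‖ ^ 2 / 2}
  have hSne : S.Nonempty := by
    obtain ⟨y, b, hb⟩ := hg.exists_coe
    exact ⟨_, y, b, hb, rfl⟩
  have hSb : BddBelow S := ⟨m₀, by rintro r ⟨y, b, hb, rfl⟩; exact hm₀ y b hb⟩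
  set m := sInf S with hm
  have hmin : ∀ (y : E) (b : ℝ), g y = b → m ≤ b + ‖x - y‖ ^ 2 / 2 :=
    fun y b hb => csInf_le hSb ⟨y, b, hb, rfl⟩
  have happrox : ∀ n : ℕ, ∃ (y : E) (b : ℝ), g y = b ∧
      b + ‖x - y‖ ^ 2 / 2 < m + 1 / ((n : ℝ) + 1) := by
    intro n
    obtain ⟨r, ⟨y, b, hb, rfl⟩, hr⟩ := exists_lt_of_csInf_lt hSne
      (show sInf S < m + 1 / ((n : ℝ) + 1) by
        have : (0 : ℝ) < 1 / ((n : ℝ) + 1) := by positivity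
        linarith)
    exact ⟨y, b, hb, hr⟩
  choose u b hb hub using happrox
  -- The objective at the midpoint is at least m, so the parallelogram law bounds ‖u n - u k‖²/8 by
  -- the average excess over m.
  have hdist : ∀ n k N : ℕ, N ≤ n → N ≤ k →
      ‖u n - u k‖ ^ 2 ≤ 8 * (1 / ((N : ℝ) + 1)) := by
    intro n k N hn hk
    obtain ⟨c, hc, hcle⟩ := hg.convex_coe (hb n) (hb k) (by norm_num : (0 : ℝ) < 1 / 2)
      (by norm_num : (0 : ℝ) < 1 / 2) (by norm_num)
    have h1 := hmin _ _ hc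
    have h2 := parallelogram_law_with_norm ℝ (x - u n) (x - u k)
    have h3 : x - ((1 / 2 : ℝ) • u n + (1 / 2 : ℝ) • u k)
        = (1 / 2 : ℝ) • ((x - u n) + (x - u k)) := by module
    rw [h3, norm_smul, Real.norm_of_nonneg (by norm_num)] at h1
    rw [sub_sub_sub_cancel_left, norm_sub_rev (u k)] at h2
    have h4 : 1 / ((n : ℝ) + 1) ≤ 1 / ((N : ℝ) + 1) :=
      one_div_le_one_div_of_le (by positivity) (by simpa using hn)
    have h5 : 1 / ((k : ℝ) + 1) ≤ 1 / ((N : ℝ) + 1) :=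
      one_div_le_one_div_of_le (by positivity) (by simpa using hk)
    have h6 := hub n
    have h7 := hub k
    nlinarith
  have hlim0 : Tendsto (fun N : ℕ => 1 / ((N : ℝ) + 1)) atTop (𝓝 0) :=
    tendsto_one_div_add_atTop_nhds_zero_nat
  have hcauchy : CauchySeq u := by
    refine cauchySeq_of_le_tendsto_0 (fun N : ℕ => √(8 * (1 / ((N : ℝ) + 1)))) ?_ ?_
    · intro n k N hn hk
      rw [dist_eq_norm]
      exact Real.le_sqrt_of_sq_le (hdist n k N hn hk)
    · simpa using ((hlim0.const_mul 8).sqrt)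
  obtain ⟨p, hp⟩ := cauchySeq_tendsto_of_complete hcauchy
  have hbound : Tendsto (fun n : ℕ => m + 1 / ((n : ℝ) + 1) - ‖x - u n‖ ^ 2 / 2) atTop
      (𝓝 (m - ‖x - p‖ ^ 2 / 2)) := by
    have h1 := ((((tendsto_const_nhds (x := x)).sub hp).norm).pow 2).div_const 2
    simpa using (hlim0.const_add m).sub h1
  -- Stated through real r < g p because g p may still be ⊤ here.
  have hle : ∀ r : ℝ, m - ‖x - p‖ ^ 2 / 2 < r → ¬ ((r : EReal) < g p) := by
    intro r hr hlt
    have h1 := hp.eventually (hg.lsc p _ hlt)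
    have h2 := hbound.eventually (gt_mem_nhds hr)
    obtain ⟨n, hn1, hn2⟩ := (h1.and h2).exists
    rw [hb n] at hn1
    have h3 : r < b n := by exact_mod_cast hn1
    have h4 := hub n
    linarith
  rcases hg.eq_top_or_coe p with htop | ⟨a, ha⟩
  · exact absurd (by rw [htop]; exact EReal.coe_lt_top _)
      (hle (m - ‖x - p‖ ^ 2 / 2 + 1) (by linarith))
  · have ham : a ≤ m - ‖x - p‖ ^ 2 / 2 := by
      by_contra! hlt
      obtain ⟨r, hr1, hr2⟩ := exists_between hlt
      exact hle r hr1 (by rw [ha]; exact_mod_cast hr2)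
    exact ⟨p, a, ha, fun y c hc => by linarith [hmin y c hc]⟩

/-- The variational inequality satisfied by a minimizer of `y ↦ g y + ‖x - y‖² / 2`. -/
lemma GammaZero.subgradient_of_minimizer {g : E → EReal} (hg : GammaZero g) {x p : E} {a : ℝ}
    (ha : g p = a)
    (hmin : ∀ (y : E) (b : ℝ), g y = b → a + ‖x - p‖ ^ 2 / 2 ≤ b + ‖x - y‖ ^ 2 / 2)
    (y : E) (b : ℝ) (hb : g y = b) : a + inner ℝ (x - p) (y - p) ≤ b := by
  -- Compare p with p + t(y - p), divide by t, then let t tend to 0.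
  have key : ∀ t : ℝ, 0 < t → t < 1 →
      a + inner ℝ (x - p) (y - p) - b ≤ t * (‖y - p‖ ^ 2 / 2) := by
    intro t ht0 ht1
    obtain ⟨c, hc, hcle⟩ := hg.convex_coe ha hb (sub_pos.2 ht1) ht0 (by ring)
    have h1 := hmin _ _ hc
    have h2 : x - ((1 - t) • p + t • y) = (x - p) - t • (y - p) := by module
    rw [h2, norm_sub_sq_real (x - p) (t • (y - p)), inner_smul_right, norm_smul, Real.norm_of_nonneg ht0.le] at h1
    refine le_of_mul_le_mul_left (a := t) ?_ ht0
    nlinarith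
  have hlim : Tendsto (fun t : ℝ => t * (‖y - p‖ ^ 2 / 2)) (𝓝[>] 0) (𝓝 0) := by
    have : Tendsto (fun t : ℝ => t * (‖y - p‖ ^ 2 / 2)) (𝓝 0) (𝓝 (0 * (‖y - p‖ ^ 2 / 2))) :=
      tendsto_id.mul_const _
    rw [zero_mul] at this
    exact this.mono_left nhdsWithin_le_nhds
  have h0 := ge_of_tendsto hlim (by
    filter_upwards [Ioo_mem_nhdsGT (zero_lt_one' ℝ)] with t ht using key t ht.1 ht.2)
  linarith

/-- The characterization of `proxOp g x` by the inclusion `x - proxOp g x ∈ ∂g (proxOp g x)`. -/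
lemma GammaZero.proxOp_spec [CompleteSpace E] {g : E → EReal} (hg : GammaZero g) (x : E) :
    ∃ a : ℝ, g (proxOp g x) = a ∧ ∀ (y : E) (b : ℝ), g y = b →
      a + inner ℝ (x - proxOp g x) (y - proxOp g x) ≤ b := by
  obtain ⟨p, a, ha, hmin⟩ := hg.exists_minimizer x
  have hsub := hg.subgradient_of_minimizer ha hmin
  have hprox : IsProx g x p := by
    intro y hy
    rw [ha, halfSqNorm, halfSqNorm]
    rcases hg.eq_top_or_coe y with htop | ⟨b, hb⟩
    · rw [htop, EReal.top_add_coe, ← EReal.coe_add]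
      exact EReal.coe_lt_top _
    · rw [hb]
      have h1 := hsub y b hb
      have h2 : x - y = (x - p) - (y - p) := by abel
      have h3 := norm_sub_sq_real (x - p) (y - p)
      rw [← h2] at h3
      have h4 : 0 < ‖y - p‖ := norm_pos_iff.2 (sub_ne_zero.2 hy)
      have h5 : a + ‖x - p‖ ^ 2 / 2 < b + ‖x - y‖ ^ 2 / 2 := by nlinarith
      exact_mod_cast h5
  rw [hprox.proxOp_eq]
  exact ⟨a, ha, hsub⟩

lemma GammaZero.norm_sq_proxOp_sub_le [CompleteSpace E] {g : E → EReal} (hg : GammaZero g)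
    (x y : E) :
    ‖proxOp g x - proxOp g y‖ ^ 2 ≤ inner ℝ (proxOp g x - proxOp g y) (x - y) := by
  obtain ⟨a, ha, hsa⟩ := hg.proxOp_spec x
  obtain ⟨b, hb, hsb⟩ := hg.proxOp_spec y
  have h1 := hsa _ _ hb
  have h2 := hsb _ _ ha
  rw [← real_inner_self_eq_norm_sq]
  simp only [inner_sub_left, inner_sub_right] at *
  linarith [real_inner_comm (proxOp g x) (proxOp g y), real_inner_comm x (proxOp g y),
    real_inner_comm y (proxOp g x), real_inner_comm x (proxOp g x),
    real_inner_comm y (proxOp g y)]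

/-! ### Moreau envelopes and their conjugates -/

/-- The Moreau envelope of `g*` is real-valued, and the proximity operator of `g` is its gradient,
with a quadratic upper bound. -/
lemma GammaZero.exists_envelope [CompleteSpace E] {g : E → EReal} (hg : GammaZero g) :
    ∃ φ : E → ℝ, (∀ z, infConv (fenchelConj g) halfSqNorm z = φ z) ∧
      (∀ z w, φ z + inner ℝ (w - z) (proxOp g z) ≤ φ w) ∧
      (∀ z w, φ w ≤ φ z + inner ℝ (w - z) (proxOp g z) + ‖w - z‖ ^ 2 / 2) := by
  choose a ha hsub using hg.proxOp_spec
  -- Equality in Fenchel–Young, since z - prox z is a subgradient at prox z.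
  have hconj : ∀ z, fenchelConj g (z - proxOp g z) =
      ((inner ℝ (proxOp g z) (z - proxOp g z) - a z : ℝ) : EReal) := by
    intro z
    refine le_antisymm (iSup_le fun y => ?_) ?_
    · rcases hg.eq_top_or_coe y with htop | ⟨b, hb⟩
      · rw [htop, EReal.sub_top]; exact bot_le
      · rw [hb, ← EReal.coe_sub, EReal.coe_le_coe_iff]
        have h1 := hsub z y b hb
        rw [inner_sub_right, real_inner_comm, real_inner_comm (proxOp g z)] at h1
        linarith
    · refine le_trans (le_of_eq ?_) (le_iSup _ (proxOp g z))
      rw [ha, EReal.coe_sub]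
  set φ : E → ℝ := fun z => inner ℝ z (proxOp g z) - a z - ‖proxOp g z‖ ^ 2 / 2 with hφ
  have hval : ∀ z, infConv (fenchelConj g) halfSqNorm z = φ z := by
    intro z
    refine le_antisymm ((iInf_le _ (z - proxOp g z)).trans (le_of_eq ?_)) (le_iInf fun y => ?_)
    · rw [hconj, halfSqNorm, sub_sub_cancel, ← EReal.coe_add, EReal.coe_eq_coe_iff, hφ]
      simp only [inner_sub_right, real_inner_self_eq_norm_sq, real_inner_comm z]
      ring
    · have h1 : ((inner ℝ (proxOp g z) y - a z : ℝ) : EReal) ≤ fenchelConj g y := by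
        refine le_trans (le_of_eq ?_) (le_iSup _ (proxOp g z))
        rw [ha, EReal.coe_sub]
      refine le_trans ?_ (add_le_add_left h1 _)
      rw [halfSqNorm, ← EReal.coe_add, EReal.coe_le_coe_iff, hφ]
      have h2 := norm_sub_sq_real (z - y) (proxOp g z)
      rw [inner_sub_left, real_inner_comm (proxOp g z) y] at h2
      have := sq_nonneg ‖z - y - proxOp g z‖
      simp only
      linarith
  have hup : ∀ z w, φ w ≤ φ z + inner ℝ (w - z) (proxOp g z) + ‖w - z‖ ^ 2 / 2 := by
    intro z w
    -- The point optimal for z is used as a competitor at w.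
    have h1 : infConv (fenchelConj g) halfSqNorm w ≤ _ := iInf_le _ (z - proxOp g z)
    rw [hval, hconj, halfSqNorm, ← EReal.coe_add, EReal.coe_le_coe_iff] at h1
    have h2 : w - (z - proxOp g z) = (w - z) + proxOp g z := by abel
    rw [h2, norm_add_sq_real, inner_sub_right, real_inner_self_eq_norm_sq,
      real_inner_comm z] at h1
    simp only [hφ] at h1 ⊢
    linarith
  refine ⟨φ, hval, fun z w => ?_, hup⟩
  have h1 := hsub w _ _ (ha z)
  have h2 : ‖proxOp g z‖ ^ 2 = ‖proxOp g w + (proxOp g z - proxOp g w)‖ ^ 2 := by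
    congr 2; abel
  rw [norm_add_sq_real] at h2
  have h3 := sq_nonneg ‖proxOp g z - proxOp g w‖
  simp only [hφ]
  simp only [inner_sub_left, inner_sub_right, real_inner_self_eq_norm_sq] at *
  linarith

/-- If `h` is a convex function with gradient `T` and quadratic upper bounds of modulus `1`, then
`h* - ‖·‖² / 2` is in `Γ₀(E)` and its proximity operator is `T`. -/
lemma gammaZero_conj_sub_halfSqNorm {h : E → ℝ} {T : E → E}
    (hlow : ∀ x y, h x + inner ℝ (y - x) (T x) ≤ h y)
    (hup : ∀ x y, h y ≤ h x + inner ℝ (y - x) (T x) + ‖y - x‖ ^ 2 / 2)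
    {f : E → EReal}
    (hf : ∀ x, f x = fenchelConj (fun z => (h z : EReal)) x - halfSqNorm x) :
    GammaZero f ∧ ∀ x, proxOp f x = T x := by
  -- Conjugating the quadratic majorant of h at y and subtracting ‖u‖²/2 leaves this function,
  -- affine in u. As a supremum of such functions, f is convex and lower semicontinuous despite
  -- being a difference.
  set A : E → E → ℝ := fun y u => inner ℝ y u - h y - inner ℝ u (T y) + ‖T y‖ ^ 2 / 2 with hA
  have hfA : ∀ u, f u = ⨆ y, (A y u : EReal) := by
    intro u
    rw [hf]
    refine le_antisymm (EReal.sub_le_of_le_add (iSup_le fun y => ?_)) (iSup_le fun y => ?_)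
    · refine le_trans ?_ (add_le_add_left (le_iSup (fun y => (A y u : EReal)) y) _)
      rw [halfSqNorm, ← EReal.coe_sub, ← EReal.coe_add, EReal.coe_le_coe_iff, hA]
      have h1 := norm_sub_sq_real u (T y)
      have := sq_nonneg ‖u - T y‖
      simp only
      linarith
    · refine (EReal.le_sub_iff_add_le (Or.inl (EReal.coe_ne_bot _))
        (Or.inl (EReal.coe_ne_top _))).2 ?_
      -- The point y + (u - T y) maximizes the conjugate of that majorant.
      refine le_trans ?_
        (le_iSup (fun x => ((inner ℝ x u : ℝ) : EReal) - (h x : EReal)) (y + (u - T y)))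
      rw [← EReal.coe_sub, ← EReal.coe_add, EReal.coe_le_coe_iff, hA]
      have h1 := hup y (y + (u - T y))
      rw [add_sub_cancel_left, norm_sub_sq_real] at h1
      simp only [inner_sub_left, inner_add_left, real_inner_self_eq_norm_sq,
        real_inner_comm u (T y)] at h1 ⊢
      linarith
  have hAle : ∀ y u, (A y u : EReal) ≤ f u := fun y u => by
    rw [hfA]; exact le_iSup (fun y => (A y u : EReal)) y
  have hfT : ∀ y, f (T y) = A y (T y) := by
    intro y
    refine le_antisymm ?_ (hAle y _)
    rw [hf]
    refine EReal.sub_le_of_le_add (iSup_le fun x => ?_)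
    rw [halfSqNorm, ← EReal.coe_sub, ← EReal.coe_add, EReal.coe_le_coe_iff, hA]
    have h1 := hlow y x
    rw [inner_sub_left] at h1
    simp only [real_inner_self_eq_norm_sq]
    linarith
  refine ⟨⟨fun u h => ?_, ⟨T 0, by rw [hfT]; exact EReal.coe_ne_top _⟩, ?_, ?_⟩, fun x => ?_⟩
  · have := hAle 0 u
    rw [h, le_bot_iff] at this
    exact EReal.coe_ne_bot _ this
  · have : f = fun u => ⨆ y, (A y u : EReal) := funext hfA
    rw [this]
    refine lowerSemicontinuous_iSup fun y => Continuous.lowerSemicontinuous ?_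
    refine continuous_coe_real_ereal.comp ?_
    simp only [hA]
    fun_prop
  · intro u v s t hs ht hst
    rw [hfA (s • u + t • v)]
    refine iSup_le fun y => ?_
    have h1 : A y (s • u + t • v) = s * A y u + t * A y v := by
      simp only [hA, inner_add_left, inner_add_right, inner_smul_left, inner_smul_right,
        RCLike.conj_to_real]
      linear_combination (‖T y‖ ^ 2 / 2 - h y) * (-hst)
    rw [h1, EReal.coe_add, EReal.coe_mul, EReal.coe_mul]
    exact add_le_add
      (mul_le_mul_of_nonneg_left (hAle y u) (by exact_mod_cast hs.le))
      (mul_le_mul_of_nonneg_left (hAle y v) (by exact_mod_cast ht.le))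
  · refine IsProx.proxOp_eq fun u hu => ?_
    -- With f replaced by A x, the prox objective at u exceeds its value at T x by exactly ‖u - T
    -- x‖²/2.
    refine lt_of_lt_of_le ?_ (add_le_add_left (hAle x u) _)
    rw [hfT, halfSqNorm, halfSqNorm, ← EReal.coe_add, ← EReal.coe_add, EReal.coe_lt_coe_iff, hA]
    have h1 := norm_sub_sq_real x (T x)
    have h2 := norm_sub_sq_real x u
    have h3 := norm_sub_sq_real u (T x)
    have h4 : 0 < ‖u - T x‖ := norm_pos_iff.2 (sub_ne_zero.2 hu)
    have h5 : 0 < ‖u - T x‖ ^ 2 := by positivity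
    simp only [real_inner_self_eq_norm_sq]
    linarith

lemma firmlyNonexpansive_of_norm_sq_le_inner {F : E → E}
    (h : ∀ x y, ‖F x - F y‖ ^ 2 ≤ inner ℝ (F x - F y) (x - y)) : FirmlyNonexpansive F := by
  intro x y
  have h1 : x - F x - (y - F y) = (x - y) - (F x - F y) := by abel
  rw [h1, norm_sub_sq_real (x - y), real_inner_comm]
  linarith [h x y]

end Prox

lemma EReal.coe_finset_sum {ι : Type*} (s : Finset ι) (f : ι → ℝ) :
    ((∑ i ∈ s, f i : ℝ) : EReal) = ∑ i ∈ s, (f i : EReal) :=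
  map_sum (⟨⟨Real.toEReal, EReal.coe_zero⟩, EReal.coe_add⟩ : ℝ →+ EReal) f s

/-! ### Aggregation through the adjoints -/

section Sum

variable {H : Type*} [NormedAddCommGroup H] [InnerProductSpace ℝ H] [CompleteSpace H]
  {ι : Type*} [Fintype ι]
  {G : ι → Type*} [∀ i, NormedAddCommGroup (G i)] [∀ i, InnerProductSpace ℝ (G i)]
  [∀ i, CompleteSpace (G i)]

lemma inner_sum_adjoint (L : ∀ i, H →L[ℝ] G i) (d : ∀ i, G i) (x : H) :
    inner ℝ x (∑ i, ContinuousLinearMap.adjoint (L i) (d i)) = ∑ i, inner ℝ (L i x) (d i) := by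
  rw [inner_sum]
  exact Finset.sum_congr rfl fun i _ => ContinuousLinearMap.adjoint_inner_right _ _ _

lemma norm_sq_sum_adjoint_le (L : ∀ i, H →L[ℝ] G i) (d : ∀ i, G i) :
    ‖∑ i, ContinuousLinearMap.adjoint (L i) (d i)‖ ^ 2 ≤ (∑ i, ‖L i‖ ^ 2) * ∑ i, ‖d i‖ ^ 2 := by
  have h1 : ‖∑ i, ContinuousLinearMap.adjoint (L i) (d i)‖ ≤ ∑ i, ‖L i‖ * ‖d i‖ := by
    refine norm_sum_le_of_le _ fun i _ => ?_
    refine (ContinuousLinearMap.le_opNorm _ _).trans (le_of_eq ?_)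
    rw [LinearIsometryEquiv.norm_map]
  exact (pow_le_pow_left₀ (norm_nonneg _) h1 2).trans (Finset.sum_mul_sq_le_sq_mul_sq _ _ _)

end Sum

theorem proposition2p6
    {H : Type*} [NormedAddCommGroup H] [InnerProductSpace ℝ H] [CompleteSpace H]
    {ι : Type*} [Fintype ι] [Nonempty ι]
    {G : ι → Type*} [∀ i, NormedAddCommGroup (G i)] [∀ i, InnerProductSpace ℝ (G i)]
    [∀ i, CompleteSpace (G i)]
    (xbar : H)
    (g : ∀ i, G i → EReal) (hg : ∀ i, GammaZero (g i))
    (L : ∀ i, H →L[ℝ] G i) (hL : ∀ i, L i ≠ 0)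
    (q : ∀ i, G i) (hq : ∀ i, q i = proxOp (g i) (L i xbar))
    (β : ℝ) (hβ : β = 1 / ∑ i, ‖L i‖ ^ 2)
    (p : H) (hp : p = β • ∑ i, ContinuousLinearMap.adjoint (L i) (q i))
    (F : H → H)
    (hF : ∀ x, F x = β • ∑ i, ContinuousLinearMap.adjoint (L i) (proxOp (g i) (L i x)))
    (f : H → EReal)
    (hf : ∀ x, f x =
      fenchelConj (fun z => ∑ i, infConv (fenchelConj (g i)) halfSqNorm (L i z)) x
        - halfSqNorm x) :
    IsProximalPoint F xbar p ∧
    (∀ x, F x = p ↔ ∀ i, proxOp (g i) (L i x) = q i) ∧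
    (1 ≤ β → GammaZero f ∧ ∀ x, F x = β • proxOp f x) := by
  have hSpos : 0 < ∑ i, ‖L i‖ ^ 2 :=
    Finset.sum_pos (fun i _ => pow_pos (norm_pos_iff.2 (hL i)) 2) Finset.univ_nonempty
  have hβpos : 0 < β := by rw [hβ]; positivity
  have hβS : β * ∑ i, ‖L i‖ ^ 2 = 1 := by rw [hβ]; field_simp
  set P : ∀ i, H → G i := fun i x => proxOp (g i) (L i x) with hP
  have hFsub : ∀ x y, F x - F y =
      β • ∑ i, ContinuousLinearMap.adjoint (L i) (P i x - P i y) := by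
    intro x y
    rw [hF, hF, ← smul_sub, ← Finset.sum_sub_distrib]
    simp only [map_sub, hP]
  have hmono : ∀ x y, β * ∑ i, ‖P i x - P i y‖ ^ 2 ≤ inner ℝ (F x - F y) (x - y) := by
    intro x y
    rw [real_inner_comm, hFsub, inner_smul_right, inner_sum_adjoint]
    refine mul_le_mul_of_nonneg_left (Finset.sum_le_sum fun i _ => ?_) hβpos.le
    rw [real_inner_comm, map_sub]
    exact (hg i).norm_sq_proxOp_sub_le _ _
  have hfirm : ∀ x y, ‖F x - F y‖ ^ 2 ≤ inner ℝ (F x - F y) (x - y) := by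
    intro x y
    refine le_trans ?_ (hmono x y)
    rw [hFsub, norm_smul, Real.norm_of_nonneg hβpos.le, mul_pow]
    calc β ^ 2 * ‖∑ i, ContinuousLinearMap.adjoint (L i) (P i x - P i y)‖ ^ 2
        ≤ β ^ 2 * ((∑ i, ‖L i‖ ^ 2) * ∑ i, ‖P i x - P i y‖ ^ 2) := by
          gcongr; exact norm_sq_sum_adjoint_le L _
      _ = β * (β * ∑ i, ‖L i‖ ^ 2) * ∑ i, ‖P i x - P i y‖ ^ 2 := by ring
      _ = β * ∑ i, ‖P i x - P i y‖ ^ 2 := by rw [hβS, mul_one]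
  have hpF : p = F xbar := by
    rw [hp, hF]; simp only [hq]
  refine ⟨⟨firmlyNonexpansive_of_norm_sq_le_inner hfirm, hpF⟩, fun x => ⟨fun hx => ?_, fun hx => ?_⟩,
    fun hβ1 => ?_⟩
  · have h1 := hmono x xbar
    rw [hx, hpF, sub_self, inner_zero_left] at h1
    have h2 : ∑ i, ‖P i x - P i xbar‖ ^ 2 = 0 :=
      le_antisymm (nonpos_of_mul_nonpos_right h1 hβpos) (Finset.sum_nonneg fun i _ => sq_nonneg _)
    rw [Finset.sum_eq_zero_iff_of_nonneg fun i _ => sq_nonneg _] at h2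
    intro i
    rw [hq i]
    exact sub_eq_zero.1 (norm_eq_zero.1 (pow_eq_zero_iff two_ne_zero |>.1 (h2 i (Finset.mem_univ i))))
  · rw [hF, hp]; simp only [hx]
  · choose φ hφ hφlow hφup using fun i => (hg i).exists_envelope
    -- This is where β ≥ 1 enters: the quadratic terms add up to modulus at most 1.
    have hS1 : ∑ i, ‖L i‖ ^ 2 ≤ 1 := by nlinarith
    have key := gammaZero_conj_sub_halfSqNorm (h := fun x => ∑ i, φ i (L i x))
      (T := fun x => ∑ i, ContinuousLinearMap.adjoint (L i) (P i x)) (f := f) ?_ ?_ ?_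
    · exact ⟨key.1, fun x => by rw [key.2, hF]⟩
    · intro x y
      rw [inner_sum_adjoint, ← Finset.sum_add_distrib]
      refine Finset.sum_le_sum fun i _ => ?_
      rw [map_sub]
      exact hφlow i _ _
    · intro x y
      have h1 : ∑ i, φ i (L i y) ≤ ∑ i, (φ i (L i x) + inner ℝ (L i (y - x)) (P i x)
          + ‖L i‖ ^ 2 * (‖y - x‖ ^ 2 / 2)) := by
        refine Finset.sum_le_sum fun i _ => ?_
        have h2 := hφup i (L i x) (L i y)
        have h3 := pow_le_pow_left₀ (norm_nonneg _) ((L i).le_opNorm (y - x)) 2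
        rw [← map_sub] at h2
        rw [mul_pow] at h3
        simp only [hP]
        linarith
      rw [Finset.sum_add_distrib, Finset.sum_add_distrib, ← Finset.sum_mul] at h1
      rw [inner_sum_adjoint]
      refine h1.trans (add_le_add_right ?_ _)
      exact mul_le_of_le_one_left (by positivity) hS1
    · intro x
      rw [hf]
      congr 2
      funext z
      rw [EReal.coe_finset_sum]
      exact Finset.sum_congr rfl fun i _ => hφ i _
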